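/- **Theorem.** Write $\log$ for the natural logarithm. Let $\mathcal Z=\mathbb R^d\times\{0,1\}$. A half-space classifier on $\mathbb R^d$ is $x\mapsto \mathbf 1[\langle w,x\rangle+b\ge 0]$ or $x\mapsto \mathbf 1[\langle w,x\rangle+b> 0]$ with $w\in\mathbb R^d$, $b\in\mathbb R$. For a probability distribution $\mathcal D$ on $\mathcal Z$ and $h:\mathbb R^d\to\{0,1\}$ let $R_{\mathcal D}(h)=\mathcal D\{(x,y): h(x)\ne y\}$; $\mathcal D$ is *realizable* if $R_{\mathcal D}(h)=0$ for some half-space classifier $h$. The (hard-margin) SVM $\mathcal A_n$ maps a linearly separable sample $((x_1,y_1),\dots,(x_n,y_n))$, $n\ge1$, to the max-margin classifier $x\mapsto \mathbf 1[\langle w,x\rangle+b\ge 0]$, where $(w,b)$ minimizes $\|w\|$ subject to $(2y_i-1)(\langle w,x_i\rangle+b)\ge 1$ for all $i$ (if only one label occurs, this is the constant classifier with that label). Its conditional mutual information is $\mathrm{CMI}_{\mathcal D}(\mathcal A_n)=I(\mathcal A_n(Z_U);U\mid Z)$, where $Z=(Z_{i,j})_{i\in\{0,1\},\,1\le j\le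 n}$ has i.i.d. entries of law $\mathcal D$, $U$ is uniform on $\{0,1\}^n$ and independent of $Z$, and $Z_U=(Z_{U_j,j})_{j=1}^n$. 1. For all integers $d\ge0$ and $n>d/2$ and every realizable $\mathcal D$, $$\mathrm{CMI}_{\mathcal D}(\mathcal A_n)\le 2(d+1)\log 2\qquad\text{and}\qquad \mathbb E_{S\sim\mathcal D^{n}}\,R_{\mathcal D}(\mathcal A_n(S))\le \frac{2(d+1)}{n}.$$ 2. The risk bound is optimal up to a constant factor: there is a universal constant $c>0$ such that for all integers $d\ge1$ and $n>d/2$ and every (possibly randomized, possibly improper) learning algorithm $\mathcal B$ mapping samples in $\mathcal Z^n$ to functions $\mathbb R^d\to\{0,1\}$, there is a realizable $\mathcal D$ with $\mathbb E\, R_{\mathcal D}(\mathcal B(S))\ge c\,(d+1)/n$, where $S\sim\mathcal D^n$ and the expectation is over $S$ and the internal randomness of $\mathcal B$. -/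

import Mathlib

open MeasureTheory
open scoped ENNReal

noncomputable section

namespace LearningTheory

/-! ### Binary classification -/

/-- A labeled example: an input together with a label (`false` is `0`, `true` is `1`). -/
abbrev Example (X : Type*) := X × Bool

/-- A classifier (hypothesis). The space of classifiers carries the product σ-algebra, that is,
the σ-algebra generated by the evaluations `h ↦ h x`. -/
abbrev Classifier (X : Type*) := X → Bool

/-- A (deterministic) learning algorithm for training samples of size `n`. -/
abbrev Learner (X : Type*) (n : ℕ) := (Fin n → Example X) → Classifier X

section Risk

variable {X : Type*} [MeasurableSpace X]

/-- The risk of a classifier: the probability that it mislabels a fresh example. -/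
def risk (D : Measure (Example X)) (h : Classifier X) : ℝ≥0∞ :=
  D {p | h p.1 ≠ p.2}

/-- A distribution is realizable by a class if some member of the class has zero risk. -/
def Realizable (H : Set (Classifier X)) (D : Measure (Example X)) : Prop :=
  ∃ h ∈ H, risk D h = 0

/-- The expected risk of a learner that is trained on `n` i.i.d. examples from `D`. -/
def expectedRisk {n : ℕ} (D : Measure (Example X)) (A : Learner X n) : ℝ≥0∞ :=
  ∫⁻ s, risk D (A s) ∂(Measure.pi fun _ : Fin n => D)

end Risk

/-! ### Mutual information and conditional mutual information -/

section Information

variable {α β γ : Type*} [MeasurableSpace α] [MeasurableSpace β] [MeasurableSpace γ]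

/-- The mutual information `I(X; Y)` (in nats) of a pair with joint law `ρ`: the Kullback–Leibler
divergence of the joint law from the product of its marginals. -/
def mutualInfo (ρ : Measure (α × β)) : ℝ≥0∞ :=
  InformationTheory.klDiv ρ (ρ.fst.prod ρ.snd)

/-- The conditional mutual information `I(X; Y | Z)`, where `μ` is the law of `Z` and `κ z` is the
conditional law of `(X, Y)` given `Z = z`: the expectation over `Z` of the disintegrated mutual
information. -/
def condMutualInfo (μ : Measure γ) (κ : γ → Measure (α × β)) : ℝ≥0∞ :=
  ∫⁻ z, mutualInfo (κ z) ∂μ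

end Information

section CMI

variable {X : Type*} [MeasurableSpace X]

/-- The law of `U = (U₁, …, Uₙ)`: i.i.d. fair coins. -/
def selectorLaw (n : ℕ) : Measure (Fin n → Bool) :=
  Measure.pi fun _ => (PMF.uniformOfFintype Bool).toMeasure

/-- The law of the supersample `Z = (Z i j)`, `i ∈ {0, 1}`, `j ∈ {1, …, n}`: `2n` i.i.d. examples
from `D`. -/
def supersampleLaw (D : Measure (Example X)) (n : ℕ) : Measure (Bool × Fin n → Example X) :=
  Measure.pi fun _ => D

/-- The training sample `z_u = (z (u j) j)_j` that the selector `u` picks from `z`. -/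
def selectSample {n : ℕ} (z : Bool × Fin n → Example X) (u : Fin n → Bool) : Fin n → Example X :=
  fun j => z (u j, j)

/-- The conditional law of `(A(Z_U), U)` given `Z = z`. As `U` is independent of `Z`, it is the law
of `(A(z_U), U)` with `z` fixed. -/
def outputSelectorLaw {n : ℕ} (A : Learner X n) (z : Bool × Fin n → Example X) :
    Measure (Classifier X × (Fin n → Bool)) :=
  (selectorLaw n).map fun u => (A (selectSample z u), u)

/-- The conditional mutual information of a learning algorithm, `I(A(Z_U); U | Z)`. -/
def CMI {n : ℕ} (D : Measure (Example X)) (A : Learner X n) : ℝ≥0∞ :=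
  condMutualInfo (supersampleLaw D n) (outputSelectorLaw A)

end CMI

/-! ### Half-spaces and the support vector machine -/

section SVM

variable {d n : ℕ}

/-- The classifier of the closed half-space `{x | 0 ≤ ⟪w, x⟫ + b}`. -/
def closedHalfspace (w : EuclideanSpace ℝ (Fin d)) (b : ℝ) :
    Classifier (EuclideanSpace ℝ (Fin d)) :=
  fun x => decide (0 ≤ inner ℝ w x + b)

/-- The classifier of the open half-space `{x | 0 < ⟪w, x⟫ + b}`. -/
def openHalfspace (w : EuclideanSpace ℝ (Fin d)) (b : ℝ) :
    Classifier (EuclideanSpace ℝ (Fin d)) :=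
  fun x => decide (0 < inner ℝ w x + b)

/-- The class of half-spaces of `ℝ^d`, closed or open; `w = 0` gives the constant classifiers. -/
def halfspaces (d : ℕ) : Set (Classifier (EuclideanSpace ℝ (Fin d))) :=
  {h | ∃ w b, h = closedHalfspace w b ∨ h = openHalfspace w b}

/-- The labels as signs: `0 ↦ -1` and `1 ↦ 1`. -/
def labelSign (y : Bool) : ℝ := if y then 1 else -1

/-- The constraints of the hard-margin problem: `yᵢ (⟪w, xᵢ⟫ + b) ≥ 1` for all `i`. -/
def HardMarginFeasible (s : Fin n → Example (EuclideanSpace ℝ (Fin d)))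
    (w : EuclideanSpace ℝ (Fin d)) (b : ℝ) : Prop :=
  ∀ i, 1 ≤ labelSign (s i).2 * (inner ℝ w (s i).1 + b)

/-- `(w, b)` solves the hard-margin problem: minimise `‖w‖` subject to the constraints (the margin
of a feasible pair is at least `1 / ‖w‖`, so this maximises the margin). -/
def IsMaxMargin (s : Fin n → Example (EuclideanSpace ℝ (Fin d)))
    (w : EuclideanSpace ℝ (Fin d)) (b : ℝ) : Prop :=
  HardMarginFeasible s w b ∧ ∀ w' b', HardMarginFeasible s w' b' → ‖w‖ ≤ ‖w'‖

open Classical in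
/-- The (hard-margin) support vector machine: it returns the half-space of a solution of the
hard-margin problem. For a non-empty linearly separable sample a solution exists and its half-space
is unique: the pair `(w, b)` is unique if both labels occur, and if only one label occurs then
`w = 0` and the half-space is the constant classifier with that label. On a sample that is not
linearly separable, where the problem has no solution, the output is the constant `0`. -/
def svm (d n : ℕ) : Learner (EuclideanSpace ℝ (Fin d)) n := fun s =>
  if h : ∃ p : EuclideanSpace ℝ (Fin d) × ℝ, IsMaxMargin s p.1 p.2 then
    closedHalfspace h.choose.1 h.choose.2
  else fun _ => false

end SVM

end LearningTheory

end

/-!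
The SVM is a stable compression scheme of size `d + 1`: among the points of a separable sample, at
most `d + 1` are essential, in the sense that their removal decreases the minimal norm of the
hard-margin problem (`card_essential_le`). This is Helly's theorem in the `(w, b)`-space of dimension
`d + 1`. Removing any other point leaves the output unchanged (`IsMaxMarginOn.svm_comp_eq`), because
the old solution stays optimal and the maximum-margin half-space is unique. By exchangeability, a
given one of `n + 1` i.i.d. points is essential with probability at most `(d + 1) / (n + 1)`
(`Realizable.measure_essential_le`).

*Risk.* If the SVM errs on a fresh point, then this point is essential for the sample enlarged by it,
so the expected risk is at most `(d + 1) / (n + 1)`.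

*Conditional mutual information.* For a fixed supersample, the output is a function `f` of the
selector `U`, and its mutual information with `U` is the entropy `H(f(U))`. By the edge-isoperimetric
inequality of the cube, summed over the fibres of `f`, this entropy is at most `log 2` times the
expected number of coordinates whose flip changes `f(U)` (`sum_log_card_fiber_le`). A flip replaces
one training point by another. If it changes the output, then one of the two is essential among
the `n + 1` points that result when both are kept. Each flip therefore contributes at most
`2 (d + 1) / (n + 1)`, and there are `n` of them.

*Lower bound.* Put mass `1 / (2n)` on each of the `d` standard basis vectors and the rest on the
origin; half-spaces realize all labellings of the basis vectors. With probability at least `1 / 2` a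
given basis vector is not in the sample, and then the learner errs on it for half of the labellings.
Averaging over the labellings bounds the risk from below by `d / (8n)`
(`mul_two_pow_le_sum_expectedRisk`). These distributions have finite support, so no measurability of
the learner in the sample is needed.
-/

namespace LearningTheory

/-! ### Edge isoperimetry in the Boolean cube -/

/-- Divided by `a + b`, this is the bound `2 p log 2 ≤ H(p)` for `p = a / (a + b) ≤ 1 / 2`, which
follows from the concavity of the binary entropy `H`. -/
lemma mul_log_add_mul_log_add_le {a b : ℝ} (ha : 0 ≤ a) (hab : a ≤ b) :
    a * Real.log a + b * Real.log b + 2 * a * Real.log 2 ≤ (a + b) * Real.log (a + b) := by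
  rcases ha.eq_or_lt with rfl | ha
  · simp
  have hb : 0 < b := ha.trans_le hab
  have hs : 0 < a + b := by positivity
  set p : ℝ := a / (a + b) with hp
  have hp2 : p ≤ 1 / 2 := by
    rw [hp, div_le_iff₀ hs]; linarith
  have hp0 : 0 ≤ p := by positivity
  have key := Real.strictConcave_binEntropy.concaveOn.2 (show (0 : ℝ) ∈ Set.Icc 0 1 by norm_num)
    (show (2⁻¹ : ℝ) ∈ Set.Icc 0 1 by norm_num) (show 0 ≤ 1 - 2 * p by linarith)
    (show 0 ≤ 2 * p by linarith) (by ring)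
  have e : (1 - 2 * p) • (0 : ℝ) + (2 * p) • (2⁻¹ : ℝ) = p := by
    simp only [smul_eq_mul]; ring
  rw [e, Real.binEntropy_zero, Real.binEntropy_two_inv,
    Real.binEntropy_eq_negMulLog_add_negMulLog_one_sub] at key
  have h1p : 1 - p = b / (a + b) := by rw [hp]; field_simp; ring
  rw [h1p, hp] at key
  simp only [Real.negMulLog, smul_eq_mul, mul_zero, zero_add] at key
  rw [Real.log_div ha.ne' hs.ne', Real.log_div hb.ne' hs.ne'] at key
  have := mul_le_mul_of_nonneg_left key hs.le
  field_simp at this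
  nlinarith [this]

/-- The vertex of the cube that differs from `u` in the coordinate `j` only. -/
def flipAt {n : ℕ} (u : Fin n → Bool) (j : Fin n) : Fin n → Bool :=
  Function.update u j (!u j)

lemma flipAt_cons_zero {n : ℕ} (x : Bool) (v : Fin n → Bool) :
    flipAt (Fin.cons x v : Fin (n + 1) → Bool) 0 = Fin.cons (!x) v := by
  simp [flipAt]

lemma flipAt_cons_succ {n : ℕ} (x : Bool) (v : Fin n → Bool) (j : Fin n) :
    flipAt (Fin.cons x v : Fin (n + 1) → Bool) j.succ = Fin.cons x (flipAt v j) := by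
  simp [flipAt, Fin.cons_update]

lemma sum_cube_succ {n : ℕ} {M : Type*} [AddCommMonoid M] (F : (Fin (n + 1) → Bool) → M) :
    ∑ u, F u = (∑ v, F (Fin.cons true v)) + ∑ v, F (Fin.cons false v) := by
  rw [← (Fin.consEquiv (fun _ => Bool)).sum_comp F, Fintype.sum_prod_type, Fintype.sum_bool]
  rfl

/-- The edge-isoperimetric inequality of the cube: a set of `m` vertices spans at most
`(m log₂ m) / 2` edges. The left-hand side counts every edge twice. -/
lemma card_inner_edges_mul_log_two_le (n : ℕ) (C : Finset (Fin n → Bool)) :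
    ((∑ u, ∑ j, if u ∈ C ∧ flipAt u j ∈ C then 1 else 0 : ℕ) : ℝ) * Real.log 2
      ≤ C.card * Real.log C.card := by
  induction n with
  | zero =>
    simp only [Finset.univ_eq_empty, Finset.sum_empty, Finset.sum_const_zero, Nat.cast_zero,
      zero_mul]
    exact mul_nonneg (by positivity) (Real.log_natCast_nonneg _)
  | succ n ih =>
    set C₁ : Finset (Fin n → Bool) := Finset.univ.filter fun v =>
      (Fin.cons true v : Fin (n + 1) → Bool) ∈ C with hC₁
    set C₀ : Finset (Fin n → Bool) := Finset.univ.filter fun v =>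
      (Fin.cons false v : Fin (n + 1) → Bool) ∈ C with hC₀
    have m₁ : ∀ v, (Fin.cons true v : Fin (n + 1) → Bool) ∈ C ↔ v ∈ C₁ := fun v => by simp [hC₁]
    have m₀ : ∀ v, (Fin.cons false v : Fin (n + 1) → Bool) ∈ C ↔ v ∈ C₀ := fun v => by simp [hC₀]
    have hcard : C.card = C₁.card + C₀.card := by
      have : ∀ {k : ℕ} (S : Finset (Fin k → Bool)), S.card = ∑ u, if u ∈ S then 1 else 0 := by
        intro k S; simp
      rw [this C, sum_cube_succ, this C₁, this C₀]
      simp only [m₁, m₀]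
    -- an edge lies within one of the two facets, or it joins them at a point of `C₁ ∩ C₀`
    have hsplit : (∑ u, ∑ j, if u ∈ C ∧ flipAt u j ∈ C then 1 else 0 : ℕ)
        = (∑ u, ∑ j, if u ∈ C₁ ∧ flipAt u j ∈ C₁ then 1 else 0)
          + (∑ u, ∑ j, if u ∈ C₀ ∧ flipAt u j ∈ C₀ then 1 else 0) + 2 * (C₁ ∩ C₀).card := by
      have hI : (C₁ ∩ C₀).card = ∑ u, if u ∈ C₁ ∧ u ∈ C₀ then 1 else 0 := by
        rw [← Finset.card_filter, Finset.filter_and]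
        congr 2 <;> ext <;> simp only [Finset.mem_filter_univ]
      have hI' : (C₁ ∩ C₀).card = ∑ u, if u ∈ C₀ ∧ u ∈ C₁ then 1 else 0 := by
        rw [Finset.inter_comm, ← Finset.card_filter, Finset.filter_and]
        congr 2 <;> ext <;> simp only [Finset.mem_filter_univ]
      rw [sum_cube_succ]
      simp only [Fin.sum_univ_succ, flipAt_cons_zero, flipAt_cons_succ, Bool.not_true,
        Bool.not_false, m₁, m₀, Finset.sum_add_distrib]
      rw [← hI, ← hI']
      ring
    have h2 : ((2 * (C₁ ∩ C₀).card : ℕ) : ℝ) ≤ 2 * (min C₁.card C₀.card : ℕ) := by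
      have : (C₁ ∩ C₀).card ≤ min C₁.card C₀.card :=
        le_min (Finset.card_le_card Finset.inter_subset_left)
          (Finset.card_le_card Finset.inter_subset_right)
      exact_mod_cast Nat.mul_le_mul_left 2 this
    have hl : 0 ≤ Real.log 2 := Real.log_nonneg (by norm_num)
    have h2' := mul_le_mul_of_nonneg_right h2 hl
    have i₁ := ih C₁
    have i₀ := ih C₀
    rw [hsplit, hcard]
    push_cast at i₁ i₀ h2' ⊢
    rcases le_total C₁.card C₀.card with h | h
    · rw [min_eq_left (by exact_mod_cast h)] at h2'
      have := mul_log_add_mul_log_add_le (a := C₁.card) (b := C₀.card) (Nat.cast_nonneg _)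
        (by exact_mod_cast h)
      linarith
    · rw [min_eq_right (by exact_mod_cast h)] at h2'
      have := mul_log_add_mul_log_add_le (a := C₀.card) (b := C₁.card) (Nat.cast_nonneg _)
        (by exact_mod_cast h)
      rw [add_comm (C₁.card : ℝ)]
      linarith

/-- The entropy bound that drives the estimate of the conditional mutual information. Written with
`U` uniform on the cube it says that `H(f(U)) ≤ log 2 · 𝔼 #{j | f(U) ≠ f(U with Uⱼ flipped)}`;
it is the edge-isoperimetric inequality, summed over the fibres of `f`. -/
lemma sum_log_card_fiber_le {n : ℕ} {α : Type*} [DecidableEq α] (f : (Fin n → Bool) → α) :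
    ∑ u, Real.log (2 ^ n / (Finset.univ.filter fun v => f v = f u).card)
      ≤ Real.log 2 * ∑ u, ∑ j, if f u ≠ f (flipAt u j) then 1 else 0 := by
  have hpos : ∀ u, (0 : ℝ) < (Finset.univ.filter fun v => f v = f u).card := fun u => by
    exact_mod_cast Finset.card_pos.2 ⟨u, by simp⟩
  have key : (∑ u, ∑ j, if f u = f (flipAt u j) then (1 : ℝ) else 0) * Real.log 2
      ≤ ∑ u, Real.log (Finset.univ.filter fun v => f v = f u).card := by
    have hmaps : ∀ u ∈ (Finset.univ : Finset (Fin n → Bool)), f u ∈ Finset.univ.image f :=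
      fun u _ => Finset.mem_image_of_mem _ (Finset.mem_univ u)
    rw [← Finset.sum_fiberwise_of_maps_to hmaps, ← Finset.sum_fiberwise_of_maps_to hmaps,
      Finset.sum_mul]
    refine Finset.sum_le_sum fun c _ => ?_
    have h := card_inner_edges_mul_log_two_le n (Finset.univ.filter fun v => f v = c)
    have e1 : ∑ u ∈ Finset.univ.filter (fun v => f v = c),
        Real.log (Finset.univ.filter fun v => f v = f u).card
        = (Finset.univ.filter fun v => f v = c).card
          * Real.log (Finset.univ.filter fun v => f v = c).card := by
      rw [← nsmul_eq_mul, ← Finset.sum_const]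
      refine Finset.sum_congr rfl fun u hu => ?_
      rw [(Finset.mem_filter.1 hu).2]
    rw [e1]
    refine le_trans (le_of_eq ?_) h
    congr 1
    push_cast
    rw [Finset.sum_filter]
    refine Finset.sum_congr rfl fun u _ => ?_
    by_cases hu : f u = c
    · simp [hu, eq_comm]
    · simp [hu]
  have e2 : ∑ u, Real.log (2 ^ n / (Finset.univ.filter fun v => f v = f u).card)
      = (∑ u : Fin n → Bool, ∑ _j : Fin n, (1 : ℝ)) * Real.log 2
        - ∑ u, Real.log (Finset.univ.filter fun v => f v = f u).card := by
    rw [Finset.sum_mul, ← Finset.sum_sub_distrib]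
    refine Finset.sum_congr rfl fun u _ => ?_
    rw [Real.log_div (by positivity) (hpos u).ne', Real.log_pow]
    simp
  have e3 : (∑ u, ∑ j, if f u ≠ f (flipAt u j) then (1 : ℝ) else 0)
      = (∑ u : Fin n → Bool, ∑ _j : Fin n, (1 : ℝ))
        - ∑ u, ∑ j, if f u = f (flipAt u j) then (1 : ℝ) else 0 := by
    simp only [← Finset.sum_sub_distrib]
    refine Finset.sum_congr rfl fun u _ => Finset.sum_congr rfl fun j _ => ?_
    by_cases h : f u = f (flipAt u j) <;> simp [h]
  rw [e2, e3]
  linarith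

/-! ### The mutual information between a selector and a function of it -/

instance (n : ℕ) : IsProbabilityMeasure (selectorLaw n) := by
  unfold selectorLaw
  have := PMF.toMeasure.isProbabilityMeasure (PMF.uniformOfFintype Bool)
  infer_instance

lemma selectorLaw_singleton {n : ℕ} (u : Fin n → Bool) : selectorLaw n {u} = (2 ^ n)⁻¹ := by
  have := PMF.toMeasure.isProbabilityMeasure (PMF.uniformOfFintype Bool)
  rw [selectorLaw, ← Set.univ_pi_singleton, Measure.pi_pi]
  simp [ENNReal.inv_pow]

lemma lintegral_selectorLaw {n : ℕ} (F : (Fin n → Bool) → ℝ≥0∞) :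
    ∫⁻ u, F u ∂selectorLaw n = (2 ^ n)⁻¹ * ∑ u, F u := by
  rw [lintegral_fintype, Finset.mul_sum]
  simp only [selectorLaw_singleton, mul_comm]

lemma integral_selectorLaw {n : ℕ} (F : (Fin n → Bool) → ℝ) :
    ∫ u, F u ∂selectorLaw n = (2 ^ n)⁻¹ * ∑ u, F u := by
  rw [integral_fintype Integrable.of_finite, Finset.mul_sum]
  simp [Measure.real, selectorLaw_singleton]

/-- Finitely many classifiers are told apart by a measurable map into a finite discrete space: the
restriction to a suitable finite set of inputs. -/
lemma exists_finset_eqOn_imp_eq {ι X : Type*} [Finite ι] (f : ι → Classifier X) :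
    ∃ T : Finset X, ∀ u v, (∀ x ∈ T, f u x = f v x) → f u = f v := by
  classical
  have := Fintype.ofFinite ι
  have h : ∀ p : ι × ι, ∃ T : Finset X, (∀ x ∈ T, f p.1 x = f p.2 x) → f p.1 = f p.2 := by
    rintro ⟨u, v⟩
    by_cases huv : f u = f v
    · exact ⟨∅, fun _ => huv⟩
    · obtain ⟨x, hx⟩ := Function.ne_iff.1 huv
      exact ⟨{x}, fun h => absurd (h x (by simp)) hx⟩
  choose T hT using h
  refine ⟨Finset.univ.biUnion T, fun u v huv => hT (u, v) fun x hx => huv x ?_⟩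
  exact Finset.mem_biUnion.2 ⟨(u, v), Finset.mem_univ _, hx⟩

/-- For `U` uniform on the cube, `I(f(U); U) = H(f(U))`. -/
lemma mutualInfo_map_selectorLaw {n : ℕ} {X : Type*} [DecidableEq (Classifier X)]
    (f : (Fin n → Bool) → Classifier X) :
    mutualInfo ((selectorLaw n).map fun u => (f u, u)) = ENNReal.ofReal
      ((2 ^ n)⁻¹ * ∑ u, Real.log (2 ^ n / (Finset.univ.filter fun v => f v = f u).card)) := by
  obtain ⟨T, hT⟩ := exists_finset_eqOn_imp_eq f
  let φ : Classifier X → T → Bool := fun h x => h x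
  have hφ : Measurable φ := measurable_pi_lambda _ fun x => measurable_pi_apply _
  have hφf : ∀ u v, φ (f u) = φ (f v) ↔ f u = f v := fun u v =>
    ⟨fun h => hT u v fun x hx => congrFun h ⟨x, hx⟩, fun h => by rw [h]⟩
  have hf : Measurable f := measurable_of_finite f
  have hg : Measurable fun u => (f u, u) := measurable_of_finite _
  set N : (Fin n → Bool) → ℕ := fun u => (Finset.univ.filter fun v => f v = f u).card with hN
  have hNpos : ∀ u, N u ≠ 0 := fun u => (Finset.card_pos.2 ⟨u, by simp⟩).ne'
  set ρ := (selectorLaw n).map fun u => (f u, u) with hρ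
  have : IsProbabilityMeasure ρ := Measure.isProbabilityMeasure_map hg.aemeasurable
  have hfst : ρ.fst = (selectorLaw n).map f := by
    rw [Measure.fst, hρ, Measure.map_map measurable_fst hg]; rfl
  have hsnd : ρ.snd = selectorLaw n := by
    rw [Measure.snd, hρ, Measure.map_map measurable_snd hg]; exact Measure.map_id
  have hν : ρ.fst.prod ρ.snd
      = ((selectorLaw n).prod (selectorLaw n)).map (Prod.map f id) := by
    rw [hfst, hsnd, ← Measure.map_prod_map _ _ hf measurable_id, Measure.map_id]
  -- the density of the joint law with respect to the product of its marginals.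
  let G : (T → Bool) × (Fin n → Bool) → ℝ≥0∞ := fun p =>
    if p.1 = φ (f p.2) then 2 ^ n / (N p.2 : ℝ≥0∞) else 0
  let g : Classifier X × (Fin n → Bool) → ℝ≥0∞ := fun p => G (φ p.1, p.2)
  have hgm : Measurable g := (measurable_of_finite G).comp (by fun_prop)
  have hgdiag : ∀ u, g (f u, u) = 2 ^ n / (N u : ℝ≥0∞) := fun u => by simp [g, G]
  have hdens : ρ = (ρ.fst.prod ρ.snd).withDensity g := by
    ext A hA
    rw [withDensity_apply _ hA, ← lintegral_indicator hA, hν,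
      lintegral_map (hgm.indicator hA) (hf.prodMap measurable_id),
      lintegral_prod_symm _ (Measurable.aemeasurable (measurable_of_finite _)), hρ,
      Measure.map_apply hg hA,
      ← lintegral_indicator_one (hg hA), lintegral_selectorLaw, lintegral_selectorLaw]
    congr 1
    refine Finset.sum_congr rfl fun u _ => ?_
    rw [lintegral_selectorLaw]
    have : ∀ v, A.indicator g (Prod.map f id (v, u))
        = if f v = f u then A.indicator g (f u, u) else 0 := by
      intro v
      by_cases h : f v = f u
      · simp [h]
      · have : g (f v, u) = 0 := by simp [g, G, hφf, h]
        simp only [Prod.map_apply, id, h, if_false]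
        simp [this]
    simp only [this]
    rw [← Finset.sum_filter, Finset.sum_const, nsmul_eq_mul]
    change _ = (2 ^ n)⁻¹ * ((N u : ℝ≥0∞) * _)
    by_cases hu : (f u, u) ∈ A
    · rw [Set.indicator_of_mem hu, Set.indicator_of_mem (by exact hu), hgdiag,
        ENNReal.mul_div_cancel (by exact_mod_cast hNpos u) (ENNReal.natCast_ne_top _),
        ENNReal.inv_mul_cancel (by simp) (by simp)]
      rfl
    · rw [Set.indicator_of_notMem hu, Set.indicator_of_notMem (by exact hu)]
      simp
  have : IsProbabilityMeasure ρ.fst := Measure.fst.instIsProbabilityMeasure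
  have : IsProbabilityMeasure ρ.snd := Measure.snd.instIsProbabilityMeasure
  have hac : ρ ≪ ρ.fst.prod ρ.snd := by
    conv_lhs => rw [hdens]
    exact withDensity_absolutelyContinuous _ _
  have hllr : llr ρ (ρ.fst.prod ρ.snd) =ᵐ[ρ] fun p => Real.log (g p).toReal := by
    have h : ρ.rnDeriv (ρ.fst.prod ρ.snd) =ᵐ[ρ] g := by
      refine hac.ae_le ?_
      have h := Measure.rnDeriv_withDensity (ρ.fst.prod ρ.snd) hgm
      rwa [← hdens] at h
    filter_upwards [h] with p hp
    rw [llr, hp]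
  have hlog : Measurable fun p => Real.log (g p).toReal :=
    Real.measurable_log.comp hgm.ennreal_toReal
  have hint : Integrable (fun p => Real.log (g p).toReal) ρ := by
    rw [hρ, integrable_map_measure hlog.aestronglyMeasurable hg.aemeasurable]
    exact Integrable.of_finite
  rw [mutualInfo, InformationTheory.klDiv_of_ac_of_integrable hac
    ((integrable_congr hllr).2 hint), integral_congr_ae hllr]
  simp only [probReal_univ, add_sub_cancel_right]
  rw [hρ, integral_map hg.aemeasurable hlog.aestronglyMeasurable, integral_selectorLaw]
  simp only [hgdiag]
  simp [N]

/-- The mutual information between the selector and the output is at most `log 2` times the expected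
number of coordinates of the selector whose flip changes the output. -/
lemma mutualInfo_outputSelectorLaw_le {n : ℕ} {X : Type*} [MeasurableSpace X] (A : Learner X n)
    (z : Bool × Fin n → Example X) [∀ h h' : Classifier X, Decidable (h ≠ h')] :
    mutualInfo (outputSelectorLaw A z) ≤ ENNReal.ofReal (Real.log 2) * ((2 ^ n)⁻¹ * ∑ u, ∑ j,
      if A (selectSample z u) ≠ A (selectSample z (flipAt u j)) then 1 else 0) := by
  classical
  rw [outputSelectorLaw, mutualInfo_map_selectorLaw fun u => A (selectSample z u)]
  have h := sum_log_card_fiber_le fun u => A (selectSample z u)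
  have h2 := mul_le_mul_of_nonneg_left h (show (0 : ℝ) ≤ (2 ^ n)⁻¹ by positivity)
  refine (ENNReal.ofReal_le_ofReal h2).trans (le_of_eq ?_)
  have hl : 0 ≤ Real.log 2 := Real.log_nonneg (by norm_num)
  rw [mul_left_comm, ENNReal.ofReal_mul hl, ENNReal.ofReal_mul (by positivity),
    ENNReal.ofReal_inv_of_pos (by positivity), ENNReal.ofReal_pow (by norm_num),
    ENNReal.ofReal_sum_of_nonneg fun u _ => Finset.sum_nonneg fun j _ => by positivity]
  congr 2
  · simp
  refine Finset.sum_congr rfl fun u _ => ?_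
  rw [ENNReal.ofReal_sum_of_nonneg fun j _ => by positivity]
  refine Finset.sum_congr rfl fun j _ => ?_
  split_ifs <;> simp

section Geometry

variable {d : ℕ} {ι : Type*}

/-- The hard-margin constraints of the points of `t` with index in `T`. -/
def FeasibleOn (t : ι → Example (EuclideanSpace ℝ (Fin d))) (T : Finset ι)
    (w : EuclideanSpace ℝ (Fin d)) (b : ℝ) : Prop :=
  ∀ i ∈ T, 1 ≤ labelSign (t i).2 * (inner ℝ w (t i).1 + b)

/-- `(w, b)` solves the hard-margin problem of the points of `t` with index in `T`. -/
def IsMaxMarginOn (t : ι → Example (EuclideanSpace ℝ (Fin d))) (T : Finset ι)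
    (w : EuclideanSpace ℝ (Fin d)) (b : ℝ) : Prop :=
  FeasibleOn t T w b ∧ ∀ w' b', FeasibleOn t T w' b' → ‖w‖ ≤ ‖w'‖

lemma FeasibleOn.mono {t : ι → Example (EuclideanSpace ℝ (Fin d))} {T T' : Finset ι}
    {w : EuclideanSpace ℝ (Fin d)} {b : ℝ} (h : FeasibleOn t T w b) (hT : T' ⊆ T) :
    FeasibleOn t T' w b :=
  fun i hi => h i (hT hi)

lemma feasibleOn_comp_equiv (t : ι → Example (EuclideanSpace ℝ (Fin d))) (σ : Equiv.Perm ι)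
    (T : Finset ι) (w : EuclideanSpace ℝ (Fin d)) (b : ℝ) :
    FeasibleOn (t ∘ σ) T w b ↔ FeasibleOn t (T.map σ.toEmbedding) w b := by
  simp only [FeasibleOn, Finset.forall_mem_map]
  rfl

/-! ### Existence and uniqueness of the maximum-margin half-space -/

lemma exists_between_finset_families (P N : Finset ι) (a c : ι → ℝ)
    (h : ∀ i ∈ P, ∀ j ∈ N, a i ≤ c j) : ∃ b, (∀ i ∈ P, a i ≤ b) ∧ ∀ j ∈ N, b ≤ c j := by
  rcases P.eq_empty_or_nonempty with rfl | hP
  · rcases N.eq_empty_or_nonempty with rfl | hN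
    · exact ⟨0, by simp, by simp⟩
    · exact ⟨N.inf' hN c, by simp, fun j hj => Finset.inf'_le c hj⟩
  · exact ⟨P.sup' hP a, fun i hi => Finset.le_sup' a hi,
      fun j hj => Finset.sup'_le hP a fun i hi => h i hi j hj⟩

/-- Eliminating `b` turns the constraints into the closed conditions `⟪w, xᵢ - xⱼ⟫ ≥ 2` for `i` of
label `1` and `j` of label `0`, so that a vector `w` of minimal norm exists by compactness. -/
lemma FeasibleOn.exists_isMaxMarginOn {t : ι → Example (EuclideanSpace ℝ (Fin d))} {T : Finset ι}
    {w₀ : EuclideanSpace ℝ (Fin d)} {b₀ : ℝ} (h₀ : FeasibleOn t T w₀ b₀) :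
    ∃ w b, IsMaxMarginOn t T w b := by
  let K : Set (EuclideanSpace ℝ (Fin d)) := {w | ∀ i ∈ T, ∀ j ∈ T, (t i).2 = true →
    (t j).2 = false → 2 ≤ inner ℝ w (t i).1 - inner ℝ w (t j).1}
  have hK : ∀ w b, FeasibleOn t T w b → w ∈ K := by
    intro w b h i hi j hj hti htj
    have h1 := h i hi
    have h2 := h j hj
    simp only [hti, htj, labelSign] at h1 h2
    norm_num at h1 h2
    linarith
  have hclosed : IsClosed K := by
    simp only [K, Set.ofPred_forall]
    refine isClosed_biInter fun i _ => isClosed_biInter fun j _ => isClosed_iInter fun _ =>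
      isClosed_iInter fun _ => isClosed_le continuous_const (by fun_prop)
  obtain ⟨w, hwK, hw⟩ := hclosed.exists_infDist_eq_dist ⟨w₀, hK _ _ h₀⟩ 0
  obtain ⟨b, hb1, hb2⟩ := exists_between_finset_families
    (T.filter fun i => (t i).2 = true) (T.filter fun i => (t i).2 = false)
    (fun i => 1 - inner ℝ w (t i).1) (fun i => -1 - inner ℝ w (t i).1) (by
      intro i hi j hj
      rw [Finset.mem_filter] at hi hj
      have := hwK i hi.1 j hj.1 hi.2 hj.2
      linarith)
  refine ⟨w, b, fun i hi => ?_, fun w' b' h' => ?_⟩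
  · cases hti : (t i).2
    · have := hb2 i (Finset.mem_filter.2 ⟨hi, hti⟩)
      simp only [labelSign]
      norm_num
      linarith
    · have := hb1 i (Finset.mem_filter.2 ⟨hi, hti⟩)
      simp only [labelSign]
      norm_num
      linarith
  · have := Metric.infDist_le_dist_of_mem (x := 0) (hK _ _ h')
    rw [hw, dist_zero_left, dist_zero_left] at this
    exact this

/-- The vector `w` is unique by strict convexity. If `w ≠ 0` admitted two offsets, their mean would
satisfy the constraints with slack, so that `w` could be scaled down. If `w = 0` then all labels
agree and the half-space is trivial. -/
lemma IsMaxMargin.closedHalfspace_eq {n : ℕ} (hn : 0 < n)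
    {s : Fin n → Example (EuclideanSpace ℝ (Fin d))} {w w' : EuclideanSpace ℝ (Fin d)} {b b' : ℝ}
    (h : IsMaxMargin s w b) (h' : IsMaxMargin s w' b') :
    closedHalfspace w b = closedHalfspace w' b' := by
  have hmid : HardMarginFeasible s ((1 / 2 : ℝ) • w + (1 / 2 : ℝ) • w')
      (1 / 2 * b + 1 / 2 * b') := by
    intro i
    have h1 := h.1 i
    have h2 := h'.1 i
    rw [inner_add_left, real_inner_smul_left, real_inner_smul_left]
    linarith
  have hnorm : ‖w‖ = ‖w'‖ := le_antisymm (h.2 _ _ h'.1) (h'.2 _ _ h.1)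
  obtain rfl : w = w' := by
    by_contra hne
    have := norm_combo_lt_of_ne (x := w) (y := w') (r := ‖w‖) le_rfl hnorm.ge hne
      (a := 1 / 2) (b := 1 / 2) (by norm_num) (by norm_num) (by norm_num)
    exact absurd (h.2 _ _ hmid) (not_le.2 this)
  -- the offset of a solution with `w ≠ 0` is unique
  have hoff : ∀ b b', IsMaxMargin s w b → HardMarginFeasible s w b' → w ≠ 0 → ¬ b < b' := by
    intro b b' h h' hw hlt
    -- with the mean offset the constraints hold with slack `(b' - b) / 2`
    set c : ℝ := 1 + (b' - b) / 2 with hc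
    have hc1 : 1 < c := by rw [hc]; linarith
    have hc0 : 0 < c := by linarith
    have hf : HardMarginFeasible s (c⁻¹ • w) (c⁻¹ * ((b + b') / 2)) := by
      intro i
      have h1 := h.1 i
      have h2 := h' i
      rw [real_inner_smul_left, ← mul_add, mul_left_comm, ← div_eq_inv_mul, le_div_iff₀ hc0]
      cases hy : (s i).2 <;> simp only [hy, labelSign] at h1 h2 ⊢ <;> norm_num at h1 h2 ⊢ <;>
        linarith
    have h3 := h.2 _ _ hf
    rw [norm_smul, norm_inv, Real.norm_of_nonneg hc0.le] at h3
    have hwpos := norm_pos_iff.2 hw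
    have : c⁻¹ * ‖w‖ < ‖w‖ := by
      have := inv_lt_one_of_one_lt₀ hc1
      nlinarith
    linarith
  by_cases hw : w = 0
  · subst hw
    have h1 := h.1 ⟨0, hn⟩
    have h2 := h'.1 ⟨0, hn⟩
    funext x
    simp only [closedHalfspace, inner_zero_left, zero_add] at h1 h2 ⊢
    cases hy : (s ⟨0, hn⟩).2 <;> simp only [hy, labelSign] at h1 h2 <;> norm_num at h1 h2 <;>
      rw [decide_eq_decide] <;> constructor <;> intro <;> linarith
  · obtain rfl : b = b' :=
      le_antisymm (not_lt.1 (hoff b' b h' h.1 hw)) (not_lt.1 (hoff b b' h h'.1 hw))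
    rfl

lemma IsMaxMargin.svm_eq {n : ℕ} (hn : 0 < n) {s : Fin n → Example (EuclideanSpace ℝ (Fin d))}
    {w : EuclideanSpace ℝ (Fin d)} {b : ℝ} (h : IsMaxMargin s w b) :
    svm d n s = closedHalfspace w b := by
  have hex : ∃ p : EuclideanSpace ℝ (Fin d) × ℝ, IsMaxMargin s p.1 p.2 := ⟨(w, b), h⟩
  rw [svm, dif_pos hex]
  exact hex.choose_spec.closedHalfspace_eq hn h

lemma FeasibleOn.closedHalfspace_eq_label {t : ι → Example (EuclideanSpace ℝ (Fin d))}
    {T : Finset ι} {w : EuclideanSpace ℝ (Fin d)} {b : ℝ} (h : FeasibleOn t T w b) {i : ι}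
    (hi : i ∈ T) : closedHalfspace w b (t i).1 = (t i).2 := by
  have := h i hi
  cases hy : (t i).2 <;> simp only [hy, labelSign] at this <;> norm_num at this <;>
    simp only [closedHalfspace, decide_eq_true_eq, decide_eq_false_iff_not] <;> linarith

/-! ### Samples labelled by a half-space are separable with a margin -/

lemma exists_pos_le_of_forall_pos [Finite ι] (f : ι → ℝ) (hf : ∀ i, 0 < f i) :
    ∃ ε > 0, ∀ i, ε ≤ f i := by
  cases isEmpty_or_nonempty ι
  · exact ⟨1, one_pos, fun i => isEmptyElim i⟩
  · obtain ⟨i, hi⟩ := Finite.exists_min f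
    exact ⟨f i, hf i, hi⟩

lemma exists_feasibleOn_univ [Fintype ι] {h : Classifier (EuclideanSpace ℝ (Fin d))}
    (hh : h ∈ halfspaces d) (t : ι → Example (EuclideanSpace ℝ (Fin d)))
    (ht : ∀ i, h (t i).1 = (t i).2) : ∃ w b, FeasibleOn t Finset.univ w b := by
  -- a strict separation of the finitely many points can be rescaled to unit margin
  suffices hs : ∃ (w : EuclideanSpace ℝ (Fin d)) (b : ℝ),
      ∀ i, 0 < labelSign (t i).2 * (inner ℝ w (t i).1 + b) by
    obtain ⟨w, b, hwb⟩ := hs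
    obtain ⟨ε, hε, hle⟩ := exists_pos_le_of_forall_pos _ hwb
    refine ⟨ε⁻¹ • w, ε⁻¹ * b, fun i _ => ?_⟩
    rw [real_inner_smul_left, ← mul_add, mul_left_comm, ← div_eq_inv_mul, le_div_iff₀ hε, one_mul]
    exact hle i
  obtain ⟨w, b, rfl | rfl⟩ := hh
  · obtain ⟨ε, hε, hle⟩ := exists_pos_le_of_forall_pos
      (fun i => if (t i).2 then 1 else -(inner ℝ w (t i).1 + b)) (by
        intro i
        have := ht i
        cases hy : (t i).2 <;> simp only [hy, closedHalfspace, decide_eq_false_iff_not] at this ⊢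
        · simp only [Bool.false_eq_true, if_false]
          linarith
        · simp)
    refine ⟨w, b + ε / 2, fun i => ?_⟩
    have h1 := ht i
    have h2 := hle i
    cases hy : (t i).2 <;> simp only [hy, closedHalfspace, decide_eq_false_iff_not,
      decide_eq_true_eq, labelSign] at h1 h2 ⊢ <;> norm_num at h1 h2 ⊢ <;> linarith
  · obtain ⟨ε, hε, hle⟩ := exists_pos_le_of_forall_pos
      (fun i => if (t i).2 then inner ℝ w (t i).1 + b else 1) (by
        intro i
        have := ht i
        cases hy : (t i).2 <;> simp only [hy, openHalfspace, decide_eq_true_eq] at this ⊢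
        · simp
        · simpa using this)
    refine ⟨w, b - ε / 2, fun i => ?_⟩
    have h1 := ht i
    have h2 := hle i
    cases hy : (t i).2 <;> simp only [hy, openHalfspace, decide_eq_false_iff_not,
      decide_eq_true_eq, labelSign] at h1 h2 ⊢ <;> norm_num at h1 h2 ⊢ <;> linarith

/-! ### Essential points -/

/-- The families of points whose hard-margin problem, restricted to the indices in `T`, has a
feasible vector of norm less than `r`. -/
def normLt (d : ℕ) (T : Finset ι) (r : ℝ) : Set (ι → Example (EuclideanSpace ℝ (Fin d))) :=
  {t | ∃ w b, FeasibleOn t T w b ∧ ‖w‖ < r}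

/-- The constraints may be made strict by scaling, after which the existential quantifier over
`(w, b)` may be restricted to a countable dense set. -/
lemma measurableSet_normLt (T : Finset ι) (r : ℝ) : MeasurableSet (normLt d T r) := by
  obtain ⟨S, hSc, hSd⟩ := TopologicalSpace.exists_countable_dense (EuclideanSpace ℝ (Fin d) × ℝ)
  have hset : normLt d T r = ⋃ p ∈ S, ⋃ (_ : ‖p.1‖ < r), ⋂ i ∈ T,
      {t : ι → Example (EuclideanSpace ℝ (Fin d)) |
        1 < labelSign (t i).2 * (inner ℝ p.1 (t i).1 + p.2)} := by
    ext t
    simp only [Set.mem_iUnion, Set.mem_iInter, Set.mem_ofPred_eq, exists_prop]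
    constructor
    · rintro ⟨w, b, h, hlt⟩
      have hr : 0 < r := (norm_nonneg w).trans_lt hlt
      have hopen : IsOpen {p : EuclideanSpace ℝ (Fin d) × ℝ | ‖p.1‖ < r ∧
          ∀ i ∈ T, 1 < labelSign (t i).2 * (inner ℝ p.1 (t i).1 + p.2)} := by
        refine (isOpen_lt continuous_fst.norm continuous_const).inter ?_
        have : {p : EuclideanSpace ℝ (Fin d) × ℝ | ∀ i ∈ T, 1 < labelSign (t i).2 *
            (inner ℝ p.1 (t i).1 + p.2)} = ⋂ i ∈ T, {p | 1 < labelSign (t i).2 *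
            (inner ℝ p.1 (t i).1 + p.2)} := by ext; simp
        change IsOpen {p : EuclideanSpace ℝ (Fin d) × ℝ | ∀ i ∈ T, 1 < labelSign (t i).2 *
            (inner ℝ p.1 (t i).1 + p.2)}
        rw [this]
        exact isOpen_biInter_finset fun i _ => isOpen_lt continuous_const (by fun_prop)
      -- a factor with `1 < c` and `c * ‖w‖ < r`
      set c : ℝ := 2 * r / (r + ‖w‖) with hc
      have hpos : 0 < r + ‖w‖ := by positivity
      have hc1 : 1 < c := by rw [hc, lt_div_iff₀ hpos]; linarith
      have hc0 : 0 < c := by linarith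
      obtain ⟨p, hp, hpS⟩ := hSd.inter_open_nonempty _ hopen ⟨(c • w, c * b), by
        constructor
        · rw [norm_smul, Real.norm_of_nonneg hc0.le, hc, div_mul_eq_mul_div, div_lt_iff₀ hpos]
          nlinarith
        · intro i hi
          rw [real_inner_smul_left, ← mul_add, mul_left_comm]
          have := h i hi
          nlinarith⟩
      exact ⟨p, hpS, hp.1, hp.2⟩
    · rintro ⟨p, -, hlt, h⟩
      exact ⟨p.1, p.2, fun i hi => (h i hi).le, hlt⟩
  rw [hset]
  have hlabel : Measurable labelSign := measurable_of_finite _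
  refine MeasurableSet.biUnion hSc fun p _ => MeasurableSet.iUnion fun _ =>
    T.measurableSet_biInter fun i _ => measurableSet_lt measurable_const ?_
  fun_prop

variable [Fintype ι] [DecidableEq ι]

/-- The families of points of which the `i`-th is essential: its removal decreases the minimal norm
of the hard-margin problem. The decrease is witnessed by a rational threshold, so that this event
is visibly measurable. -/
def essential (d : ℕ) (i : ι) : Set (ι → Example (EuclideanSpace ℝ (Fin d))) :=
  {t | ∃ q : ℚ, t ∈ normLt d (Finset.univ.erase i) q ∧ t ∉ normLt d Finset.univ q}

lemma IsMaxMarginOn.erase {t : ι → Example (EuclideanSpace ℝ (Fin d))} {i : ι}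
    {w : EuclideanSpace ℝ (Fin d)} {b : ℝ} (h : IsMaxMarginOn t Finset.univ w b)
    (hi : t ∉ essential d i) : IsMaxMarginOn t (Finset.univ.erase i) w b := by
  refine ⟨h.1.mono (Finset.erase_subset _ _), fun w' b' h' => ?_⟩
  by_contra! hlt
  obtain ⟨q, hq1, hq2⟩ := exists_rat_btwn hlt
  refine hi ⟨q, ⟨w', b', h', hq1⟩, ?_⟩
  rintro ⟨w'', b'', h'', hlt'⟩
  exact absurd (h.2 _ _ h'') (not_le.2 (hlt'.trans hq2))

/-- The half-spaces of the constraints and the cylinder `{(w, b) | ‖w‖ < ‖w*‖}`, with `w*` optimal,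
have no common point. By Helly's theorem in dimension `d + 1`, neither have some `d + 2` of these
convex sets; the cylinder is among them, and all essential points belong to the other `d + 1`. -/
lemma card_essential_le {t : ι → Example (EuclideanSpace ℝ (Fin d))}
    (h₀ : ∃ w b, FeasibleOn t Finset.univ w b) (I : Finset ι) (hI : ∀ i ∈ I, t ∈ essential d i) :
    I.card ≤ d + 1 := by
  obtain ⟨w₀, b₀, h₀⟩ := h₀
  obtain ⟨w, b, hw⟩ := h₀.exists_isMaxMarginOn
  let C : Option ι → Set (EuclideanSpace ℝ (Fin d) × ℝ) := fun o =>
    o.elim {p | ‖p.1‖ < ‖w‖} fun i => {p | 1 ≤ labelSign (t i).2 * (inner ℝ p.1 (t i).1 + p.2)}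
  have hconv : ∀ o ∈ (Finset.univ : Finset (Option ι)), Convex ℝ (C o) := by
    rintro (_ | i) -
    · have : C none = (LinearMap.fst ℝ (EuclideanSpace ℝ (Fin d)) ℝ) ⁻¹' Metric.ball 0 ‖w‖ := by
        ext p; simp [C]
      rw [this]
      exact (convex_ball _ _).linear_preimage _
    · intro p hp q hq a c ha hc hac
      simp only [C, Option.elim, Set.mem_ofPred_eq] at hp hq ⊢
      simp only [Prod.fst_add, Prod.smul_fst, Prod.snd_add, Prod.smul_snd, inner_add_left,
        real_inner_smul_left, smul_eq_mul]
      have h1 := mul_le_mul_of_nonneg_left hp ha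
      have h2 := mul_le_mul_of_nonneg_left hq hc
      linarith
  have hrank : Module.finrank ℝ (EuclideanSpace ℝ (Fin d) × ℝ) = d + 1 := by simp
  obtain ⟨J, hJcard, hJ⟩ :
      ∃ J : Finset (Option ι), J.card ≤ d + 2 ∧ ¬ (⋂ o ∈ J, C o).Nonempty := by
    by_contra! hcon
    obtain ⟨p, hp⟩ := Convex.helly_theorem' (𝕜 := ℝ) hconv fun J _ hJ =>
      hcon J (by rw [hrank] at hJ; exact hJ)
    simp only [Set.mem_iInter, Finset.mem_univ, true_imp_iff] at hp
    have h1 : ‖p.1‖ < ‖w‖ := hp none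
    exact absurd (hw.2 p.1 p.2 fun i _ => hp (some i)) (not_le.2 h1)
  -- the optimal pair lies in all the constraint sets
  have hnone : none ∈ J := by
    by_contra hnone
    refine hJ ⟨(w, b), ?_⟩
    simp only [Set.mem_iInter]
    rintro (_ | i) ho
    · exact absurd ho hnone
    · exact hw.1 i (Finset.mem_univ i)
  have hsub : I.map Function.Embedding.some ⊆ J.erase none := by
    intro o ho
    obtain ⟨i, hi, rfl⟩ := Finset.mem_map.1 ho
    refine Finset.mem_erase.2 ⟨by simp, ?_⟩
    by_contra hiJ
    obtain ⟨q, ⟨w', b', h', hlt⟩, hq⟩ := hI i hi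
    have hqw : (q : ℝ) ≤ ‖w‖ := not_lt.1 fun hlt => hq ⟨w, b, hw.1, hlt⟩
    refine hJ ⟨(w', b'), ?_⟩
    simp only [Set.mem_iInter]
    rintro (_ | k) hk
    · exact hlt.trans_le hqw
    · refine h' k (Finset.mem_erase.2 ⟨?_, Finset.mem_univ k⟩)
      rintro rfl
      exact hiJ hk
  have := Finset.card_le_card hsub
  rw [Finset.card_map, Finset.card_erase_of_mem hnone] at this
  omega

lemma comp_mem_essential_iff (t : ι → Example (EuclideanSpace ℝ (Fin d))) (σ : Equiv.Perm ι)
    (i : ι) : t ∘ σ ∈ essential d i ↔ t ∈ essential d (σ i) := by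
  simp only [essential, normLt, Set.mem_ofPred_eq, feasibleOn_comp_equiv]
  rw [Finset.map_univ_equiv, Finset.map_erase, Finset.map_univ_equiv]
  rfl

lemma hardMarginFeasible_comp_iff {n : ℕ} (t : ι → Example (EuclideanSpace ℝ (Fin d)))
    (e : Fin n → ι) (i : ι) (he : ∀ k, k ∈ Set.range e ↔ k ≠ i)
    (w : EuclideanSpace ℝ (Fin d)) (b : ℝ) :
    HardMarginFeasible (t ∘ e) w b ↔ FeasibleOn t (Finset.univ.erase i) w b := by
  constructor
  · intro h k hk
    obtain ⟨j, rfl⟩ := (he k).2 (Finset.ne_of_mem_erase hk)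
    exact h j
  · intro h j
    exact h (e j) (Finset.mem_erase.2 ⟨(he _).1 ⟨j, rfl⟩, Finset.mem_univ _⟩)

/-- Removing a point that is not essential does not change the maximum-margin half-space. -/
lemma IsMaxMarginOn.svm_comp_eq {n : ℕ} (hn : 0 < n)
    {t : ι → Example (EuclideanSpace ℝ (Fin d))} {w : EuclideanSpace ℝ (Fin d)} {b : ℝ}
    (h : IsMaxMarginOn t Finset.univ w b) {i : ι} (hi : t ∉ essential d i)
    (e : Fin n → ι) (he : ∀ k, k ∈ Set.range e ↔ k ≠ i) :
    svm d n (t ∘ e) = closedHalfspace w b := by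
  refine IsMaxMargin.svm_eq hn ?_
  simp only [IsMaxMargin, hardMarginFeasible_comp_iff t e i he]
  exact h.erase hi

lemma measurableSet_essential (i : ι) : MeasurableSet (essential d i) := by
  have : essential d i = ⋃ q : ℚ, normLt d (Finset.univ.erase i) q \ normLt d Finset.univ q := by
    ext; simp [essential]
  rw [this]
  exact MeasurableSet.iUnion fun q =>
    (measurableSet_normLt _ _).diff (measurableSet_normLt _ _)

end Geometry

section Probability

variable {d n : ℕ}

/-! ### Exchangeability -/

lemma measurePreserving_comp_injective {α ι κ : Type*} [MeasurableSpace α] [Fintype ι] [Fintype κ]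
    (D : Measure α) [IsProbabilityMeasure D] {g : κ → ι} (hg : Function.Injective g) :
    MeasurePreserving (fun t : ι → α => t ∘ g) (Measure.pi fun _ => D) (Measure.pi fun _ => D) := by
  refine ⟨by fun_prop, ?_⟩
  have h := (ProbabilityTheory.iIndepFun_pi (X := fun (_ : ι) (x : α) => x)
    (μ := fun _ => D) fun _ => aemeasurable_id).precomp hg
  rw [ProbabilityTheory.iIndepFun_iff_map_fun_eq_pi_map fun k =>
    (measurable_pi_apply (g k)).aemeasurable] at h
  refine h.trans ?_
  congr 1
  funext k
  exact (measurePreserving_eval (fun _ : ι => D) (g k)).map_eq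

variable {D : Measure (Example (EuclideanSpace ℝ (Fin d)))} [IsProbabilityMeasure D]

lemma Realizable.ae_exists_feasibleOn {ι : Type*} [Fintype ι] (hD : Realizable (halfspaces d) D) :
    ∀ᵐ t ∂Measure.pi fun _ : ι => D, ∃ w b, FeasibleOn t Finset.univ w b := by
  obtain ⟨h, hh, hrisk⟩ := hD
  have hae : ∀ᵐ p ∂D, h p.1 = p.2 := hrisk
  have hall : ∀ᵐ t ∂Measure.pi fun _ : ι => D, ∀ i, h (t i).1 = (t i).2 :=
    ae_all_iff.2 fun i => (measurePreserving_eval (fun _ => D) i).quasiMeasurePreserving.ae hae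
  filter_upwards [hall] with t ht
  exact exists_feasibleOn_univ hh t ht

/-- The points of an i.i.d. sample are equally likely to be essential, and at most `d + 1` of them
are. -/
lemma Realizable.measure_essential_le (hD : Realizable (halfspaces d) D) (i : Fin (n + 1)) :
    (Measure.pi fun _ : Fin (n + 1) => D) (essential d i) ≤ (d + 1) / (n + 1) := by
  classical
  set μ := Measure.pi fun _ : Fin (n + 1) => D with hμ
  have hsame : ∀ k, μ (essential d k) = μ (essential d i) := by
    intro k
    rw [← (measurePreserving_comp_injective D (Equiv.swap i k).injective).measure_preimage
      (measurableSet_essential i).nullMeasurableSet]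
    congr 1
    ext t
    rw [Set.mem_preimage, comp_mem_essential_iff, Equiv.swap_apply_left]
  have hsum : ∑ k : Fin (n + 1), μ (essential d k) ≤ d + 1 := by
    calc ∑ k : Fin (n + 1), μ (essential d k)
        = ∫⁻ t, ∑ k : Fin (n + 1), (essential d k).indicator 1 t ∂μ := by
          rw [lintegral_finsetSum _ fun k _ => measurable_one.indicator (measurableSet_essential k)]
          simp only [lintegral_indicator_one (measurableSet_essential _)]
      _ ≤ ∫⁻ _, (d + 1 : ℝ≥0∞) ∂μ := by
          refine lintegral_mono_ae ?_
          filter_upwards [hD.ae_exists_feasibleOn (ι := Fin (n + 1))] with t ht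
          have h := card_essential_le ht (Finset.univ.filter fun k => t ∈ essential d k)
            fun k hk => (Finset.mem_filter.1 hk).2
          simp only [Set.indicator_apply, Pi.one_apply, Finset.sum_boole]
          exact_mod_cast h
      _ = d + 1 := by simp
  simp only [hsame, Finset.sum_const, Finset.card_univ, Fintype.card_fin, nsmul_eq_mul] at hsum
  rw [ENNReal.le_div_iff_mul_le (by simp) (by simp), mul_comm]
  exact_mod_cast hsum

lemma two_mul_div_succ_le (hn : 0 < n) :
    (n : ℝ≥0∞) * ((d + 1) / (n + 1) + (d + 1) / (n + 1)) ≤ ENNReal.ofReal (2 * ((d : ℝ) + 1)) := by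
  have e : ((d : ℝ≥0∞) + 1) / (n + 1) = ENNReal.ofReal (((d : ℝ) + 1) / (n + 1)) := by
    rw [ENNReal.ofReal_div_of_pos (by positivity), ENNReal.ofReal_add (by positivity) one_pos.le,
      ENNReal.ofReal_add (by positivity) one_pos.le]
    simp
  rw [e, ← ENNReal.ofReal_natCast n, ← ENNReal.ofReal_add (by positivity) (by positivity),
    ← ENNReal.ofReal_mul (by positivity)]
  refine ENNReal.ofReal_le_ofReal ?_
  rw [← add_div, mul_div_assoc', div_le_iff₀ (by positivity)]
  nlinarith [show (0 : ℝ) ≤ d from Nat.cast_nonneg d]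

/-! ### The risk and the conditional mutual information of the SVM -/

/-- The leave-one-out bound: the SVM can err on a fresh point only if that point is essential for
the sample enlarged by it. -/
lemma Realizable.expectedRisk_svm_le (hD : Realizable (halfspaces d) D) (hn : 0 < n) :
    expectedRisk D (svm d n) ≤ (d + 1) / (n + 1) := by
  refine le_trans ?_ (hD.measure_essential_le (n := n) 0)
  have hmp := (measurePreserving_piFinSuccAbove (fun _ : Fin (n + 1) => D) 0).symm
  rw [← hmp.measure_preimage (measurableSet_essential 0).nullMeasurableSet,
    Measure.prod_apply_symm (hmp.measurable (measurableSet_essential 0)), expectedRisk]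
  obtain ⟨h, hh, hrisk⟩ := id hD
  have hae : ∀ᵐ p ∂D, h p.1 = p.2 := hrisk
  have hall : ∀ᵐ s ∂Measure.pi fun _ : Fin n => D, ∀ i, h (s i).1 = (s i).2 :=
    ae_all_iff.2 fun i => (measurePreserving_eval (fun _ => D) i).quasiMeasurePreserving.ae hae
  refine lintegral_mono_ae ?_
  filter_upwards [hall] with s hs
  refine measure_mono_ae ?_
  filter_upwards [hae] with p hp (herr : svm d n s p.1 ≠ p.2)
  change (MeasurableEquiv.piFinSuccAbove (fun _ => Example (EuclideanSpace ℝ (Fin d))) 0).symm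
    (p, s) ∈ essential d 0
  set t : Fin (n + 1) → Example (EuclideanSpace ℝ (Fin d)) := Fin.cons p s with ht
  have hts : (MeasurableEquiv.piFinSuccAbove (fun _ => Example (EuclideanSpace ℝ (Fin d))) 0).symm
      (p, s) = t := by
    simp [MeasurableEquiv.piFinSuccAbove, Fin.insertNthEquiv, ht]
  rw [hts]
  by_contra hess
  obtain ⟨w₀, b₀, h₀⟩ := exists_feasibleOn_univ hh t (Fin.cases hp hs)
  obtain ⟨w, b, hwb⟩ := h₀.exists_isMaxMarginOn
  have hsvm := hwb.svm_comp_eq hn hess Fin.succ (by simp)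
  rw [show t ∘ Fin.succ = s from rfl] at hsvm
  exact herr (hsvm ▸ hwb.1.closedHalfspace_eq_label (Finset.mem_univ 0))

/-- The `n + 1` positions of the supersample that occur in the training samples selected by `u` and
by `u` with its coordinate `j` flipped. -/
def flipIndex (u : Fin n → Bool) (j : Fin n) : Fin (n + 1) → Bool × Fin n :=
  Fin.cons (!u j, j) fun k => (u k, k)

lemma flipIndex_injective (u : Fin n → Bool) (j : Fin n) : Function.Injective (flipIndex u j) := by
  rw [flipIndex, Fin.cons_injective_iff]
  refine ⟨?_, fun k k' h => (Prod.ext_iff.1 h).2⟩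
  rintro ⟨k, hk⟩
  rw [Prod.mk.injEq] at hk
  obtain ⟨h1, rfl⟩ := hk
  cases h : u k <;> simp [h] at h1

/-- Both selected samples arise from the `n + 1` points at the positions `flipIndex u j` by the
removal of one point. -/
lemma svm_selectSample_flipAt_eq {u : Fin n → Bool} {j : Fin n}
    {z : Bool × Fin n → Example (EuclideanSpace ℝ (Fin d))}
    (hsep : ∃ w b, FeasibleOn (z ∘ flipIndex u j) Finset.univ w b)
    (h₀ : z ∘ flipIndex u j ∉ essential d 0) (h₁ : z ∘ flipIndex u j ∉ essential d j.succ) :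
    svm d n (selectSample z u) = svm d n (selectSample z (flipAt u j)) := by
  have hn : 0 < n := j.pos
  obtain ⟨w₀, b₀, hf⟩ := hsep
  obtain ⟨w, b, hwb⟩ := hf.exists_isMaxMarginOn
  have e₀ := hwb.svm_comp_eq hn h₀ Fin.succ (by simp)
  have e₁ := hwb.svm_comp_eq hn h₁ (fun k => if k = j then 0 else k.succ) (by
    intro k
    refine Fin.cases ?_ (fun k => ?_) k
    · exact iff_of_true ⟨j, if_pos rfl⟩ (Fin.succ_ne_zero j).symm
    · simp only [Set.mem_range, ne_eq, Fin.succ_inj]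
      constructor
      · rintro ⟨l, hl⟩ rfl
        split_ifs at hl with h
        · exact Fin.succ_ne_zero _ hl.symm
        · exact h (Fin.succ_injective _ hl)
      · exact fun h => ⟨k, by simp [h]⟩)
  rw [show selectSample z u = (z ∘ flipIndex u j) ∘ Fin.succ from rfl, e₀, ← e₁]
  congr 1
  funext k
  by_cases hk : k = j
  · subst hk; simp [selectSample, flipAt, flipIndex]
  · simp [selectSample, flipAt, flipIndex, hk]

lemma Realizable.cmi_svm_le (hD : Realizable (halfspaces d) D) (hn : 0 < n) :
    CMI D (svm d n) ≤ ENNReal.ofReal (2 * ((d : ℝ) + 1) * Real.log 2) := by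
  classical
  have hmeas : ∀ (u : Fin n → Bool) (j : Fin n),
      MeasurePreserving (fun z : Bool × Fin n → Example (EuclideanSpace ℝ (Fin d)) =>
        z ∘ flipIndex u j) (supersampleLaw D n) (Measure.pi fun _ => D) := fun u j =>
    measurePreserving_comp_injective D (flipIndex_injective u j)
  let E : (Fin n → Bool) → Fin n → Fin (n + 1) →
      Set (Bool × Fin n → Example (EuclideanSpace ℝ (Fin d))) := fun u j k =>
    (fun z => z ∘ flipIndex u j) ⁻¹' essential d k
  have hE : ∀ u j k, MeasurableSet (E u j k) := fun u j k =>
    (hmeas u j).measurable (measurableSet_essential k)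
  have hEle : ∀ u j k, supersampleLaw D n (E u j k) ≤ (d + 1) / (n + 1) := fun u j k => by
    rw [(hmeas u j).measure_preimage (measurableSet_essential k).nullMeasurableSet]
    exact hD.measure_essential_le k
  have hm : ∀ u j, Measurable fun z => (E u j 0).indicator
      (1 : (Bool × Fin n → Example (EuclideanSpace ℝ (Fin d))) → ℝ≥0∞) z
      + (E u j j.succ).indicator 1 z := fun u j =>
    (measurable_one.indicator (hE u j 0)).add (measurable_one.indicator (hE u j j.succ))
  have hsep : ∀ᵐ z ∂supersampleLaw D n, ∃ w b, FeasibleOn z Finset.univ w b :=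
    hD.ae_exists_feasibleOn
  have hpt : ∀ᵐ z ∂supersampleLaw D n, mutualInfo (outputSelectorLaw (svm d n) z)
      ≤ ENNReal.ofReal (Real.log 2) * ((2 ^ n)⁻¹ * ∑ u, ∑ j,
        ((E u j 0).indicator 1 z + (E u j j.succ).indicator 1 z)) := by
    filter_upwards [hsep] with z hz
    refine (mutualInfo_outputSelectorLaw_le (svm d n) z).trans ?_
    gcongr with u _ j _
    by_cases h₀ : z ∈ E u j 0
    · rw [Set.indicator_of_mem h₀]
      split_ifs <;> simp
    by_cases h₁ : z ∈ E u j j.succ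
    · rw [Set.indicator_of_mem h₁]
      split_ifs <;> simp
    · obtain ⟨w, b, hwb⟩ := hz
      rw [if_neg (not_not.2 (svm_selectSample_flipAt_eq
        ⟨w, b, fun i _ => hwb _ (Finset.mem_univ _)⟩ h₀ h₁))]
      exact zero_le
  have hlog : (0 : ℝ) ≤ 2 * ((d : ℝ) + 1) := by positivity
  calc CMI D (svm d n)
      ≤ ∫⁻ z, ENNReal.ofReal (Real.log 2) * ((2 ^ n)⁻¹ * ∑ u, ∑ j,
          ((E u j 0).indicator 1 z + (E u j j.succ).indicator 1 z)) ∂supersampleLaw D n :=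
        lintegral_mono_ae hpt
    _ = ENNReal.ofReal (Real.log 2) * ((2 ^ n)⁻¹ * ∑ u, ∑ j,
          (supersampleLaw D n (E u j 0) + supersampleLaw D n (E u j j.succ))) := by
        rw [lintegral_const_mul' _ _ ENNReal.ofReal_ne_top, lintegral_const_mul' _ _ (by simp),
          lintegral_finsetSum _ fun u _ => Finset.measurable_sum _ fun j _ => hm u j]
        simp only [lintegral_finsetSum _ fun j _ => hm _ j]
        congr! 6 with u _ j _
        rw [lintegral_add_left (measurable_one.indicator (hE u j 0)),
          lintegral_indicator_one (hE u j 0), lintegral_indicator_one (hE u j j.succ)]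
    _ ≤ ENNReal.ofReal (Real.log 2) * ((2 ^ n)⁻¹ * ∑ _u : Fin n → Bool, ∑ _j : Fin n,
          (((d : ℝ≥0∞) + 1) / (n + 1) + (d + 1) / (n + 1))) := by
        gcongr <;> exact hEle _ _ _
    _ = ENNReal.ofReal (Real.log 2) * (n * ((d + 1) / (n + 1) + (d + 1) / (n + 1))) := by
        rw [Finset.sum_const, Finset.sum_const, Finset.card_univ, Finset.card_univ,
          nsmul_eq_mul, nsmul_eq_mul, ← mul_assoc (2 ^ n)⁻¹]
        simp only [Fintype.card_pi, Fintype.card_bool, Finset.prod_const, Finset.card_univ,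
          Fintype.card_fin, Nat.cast_pow, Nat.cast_ofNat]
        rw [ENNReal.inv_mul_cancel (by simp) (by simp), one_mul]
    _ ≤ ENNReal.ofReal (Real.log 2) * ENNReal.ofReal (2 * ((d : ℝ) + 1)) := by
        gcongr
        exact two_mul_div_succ_le hn
    _ = ENNReal.ofReal (2 * ((d : ℝ) + 1) * Real.log 2) := by
        rw [mul_comm, ENNReal.ofReal_mul hlog]

end Probability

section LowerBound

variable {d n : ℕ}

/-! ### A family of hard distributions and the lower bound -/

/-- The points of the hard distributions: at index `0` the origin with label `0`, at index `i.succ`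
the standard basis vector `eᵢ` with label `y i`. Half-spaces realize every choice of the labels `y`. -/
noncomputable def hardPoint (y : Fin d → Bool) :
    Fin (d + 1) → Example (EuclideanSpace ℝ (Fin d)) :=
  Fin.cons (0, false) fun i => (EuclideanSpace.single i 1, y i)

lemma hardPoint_injective (y : Fin d → Bool) : Function.Injective (hardPoint y) := by
  have h0 : ∀ i : Fin d, EuclideanSpace.single i (1 : ℝ) ≠ 0 := fun i h => by
    simpa using congrFun (congrArg WithLp.ofLp h) i
  rw [hardPoint, Fin.cons_injective_iff]
  refine ⟨?_, fun i j h => ?_⟩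
  · rintro ⟨i, hi⟩
    exact h0 i (congrArg Prod.fst hi)
  · by_contra hij
    have := congrFun (congrArg WithLp.ofLp (congrArg Prod.fst h)) i
    simp [hij] at this

/-- The law on the indices of the hard points: each basis vector has mass `1 / (2n)`, the origin has
the remaining mass. -/
noncomputable def hardIndexLaw (d n : ℕ) : Measure (Fin (d + 1)) :=
  ENNReal.ofReal (1 - d / (2 * n)) • Measure.dirac 0
    + ENNReal.ofReal (1 / (2 * n)) • ∑ i : Fin d, Measure.dirac i.succ

lemma isProbabilityMeasure_hardIndexLaw (hn : (d : ℝ) / 2 < n) :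
    IsProbabilityMeasure (hardIndexLaw d n) := by
  have hn0 : (0 : ℝ) < n := lt_of_le_of_lt (by positivity) hn
  refine ⟨?_⟩
  simp only [hardIndexLaw, Measure.add_apply, Measure.smul_apply, Measure.finsetSum_apply,
    measure_univ, Finset.sum_const, Finset.card_univ, Fintype.card_fin, smul_eq_mul, mul_one,
    nsmul_eq_mul]
  rw [← ENNReal.ofReal_natCast d, ← ENNReal.ofReal_mul (by positivity), ← ENNReal.ofReal_add,
    ← ENNReal.ofReal_one]
  · congr 1; ring
  · rw [sub_nonneg, div_le_one (by positivity)]; linarith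
  · positivity

lemma hardIndexLaw_succ (i : Fin d) :
    hardIndexLaw d n {i.succ} = ENNReal.ofReal (1 / (2 * n)) := by
  simp only [hardIndexLaw, Measure.add_apply, Measure.smul_apply, Measure.finsetSum_apply,
    Measure.dirac_apply' _ (MeasurableSet.singleton _), Set.indicator_apply,
    Set.mem_singleton_iff]
  simp [(Fin.succ_ne_zero i).symm]

/-- The hard distribution with labels `y`. -/
noncomputable def hardLaw (n : ℕ) (y : Fin d → Bool) :
    Measure (Example (EuclideanSpace ℝ (Fin d))) :=
  (hardIndexLaw d n).map (hardPoint y)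

lemma measurableEmbedding_of_finite {α β : Type*} [Finite α] [MeasurableSpace α]
    [MeasurableSingletonClass α] [MeasurableSpace β] [MeasurableSingletonClass β] {f : α → β}
    (hf : Function.Injective f) : MeasurableEmbedding f :=
  ⟨hf, measurable_of_finite f, fun {s} _ => ((Set.toFinite s).image f).measurableSet⟩

lemma realizable_hardLaw (y : Fin d → Bool) :
    Realizable (halfspaces d) (hardLaw n y) := by
  refine ⟨_, ⟨WithLp.toLp 2 fun i => if y i then 1 else -1, -1 / 2, Or.inl rfl⟩, ?_⟩
  rw [risk, hardLaw, (measurableEmbedding_of_finite (hardPoint_injective y)).map_apply]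
  convert measure_empty (μ := hardIndexLaw d n)
  rw [Set.eq_empty_iff_forall_notMem]
  refine Fin.cases (fun h => ?_) fun i h => ?_
  · apply h
    simp only [hardPoint, Fin.cons_zero, closedHalfspace, inner_zero_right]
    norm_num
  · apply h
    simp only [hardPoint, Fin.cons_succ, closedHalfspace, EuclideanSpace.inner_single_right]
    cases y i <;> norm_num

/-- The expected risk under a hard distribution as a finite sum over the possible training samples
and test points. -/
lemma expectedRisk_hardLaw (hn : (d : ℝ) / 2 < n)
    (A : Learner (EuclideanSpace ℝ (Fin d)) n) (y : Fin d → Bool) :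
    expectedRisk (hardLaw n y) A = ∑ a : Fin n → Fin (d + 1), ∑ o : Fin (d + 1),
      Measure.pi (fun _ => hardIndexLaw d n) {a} * hardIndexLaw d n {o} *
        if A (hardPoint y ∘ a) (hardPoint y o).1 ≠ (hardPoint y o).2 then 1 else 0 := by
  have := isProbabilityMeasure_hardIndexLaw hn
  have he := measurableEmbedding_of_finite (hardPoint_injective y)
  have hpi : Measure.pi (fun _ : Fin n => hardLaw n y)
      = (Measure.pi fun _ : Fin n => hardIndexLaw d n).map fun a => hardPoint y ∘ a := by
    have : IsProbabilityMeasure ((hardIndexLaw d n).map (hardPoint y)) :=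
      Measure.isProbabilityMeasure_map he.measurable.aemeasurable
    exact (Measure.pi_map_pi fun _ => he.measurable.aemeasurable).symm
  rw [expectedRisk, hpi, (measurableEmbedding_of_finite (he.injective.comp_left)).lintegral_map,
    lintegral_fintype]
  refine Finset.sum_congr rfl fun a _ => ?_
  rw [risk, hardLaw, he.map_apply, ← lintegral_indicator_one (Set.toFinite _).measurableSet,
    lintegral_fintype, Finset.sum_mul]
  refine Finset.sum_congr rfl fun o _ => ?_
  by_cases h : A (hardPoint y ∘ a) (hardPoint y o).1 ≠ (hardPoint y o).2
  · rw [Set.indicator_of_mem (by exact h), if_pos h, Pi.one_apply]; ring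
  · rw [Set.indicator_of_notMem (by exact h), if_neg h]; ring

/-- With probability at least `1 / 2` a given basis vector does not occur in the training sample. -/
lemma one_le_two_mul_measure_avoid (hn : (d : ℝ) / 2 < n) (i : Fin d) :
    1 ≤ 2 * Measure.pi (fun _ : Fin n => hardIndexLaw d n) {a | ∀ k, a k ≠ i.succ} := by
  have := isProbabilityMeasure_hardIndexLaw hn
  have hn0 : (0 : ℝ) < n := lt_of_le_of_lt (by positivity) hn
  have hn1 : (1 : ℝ) ≤ n := by
    have : 0 < n := by exact_mod_cast hn0
    exact_mod_cast this
  have hset : {a : Fin n → Fin (d + 1) | ∀ k, a k ≠ i.succ}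
      = Set.univ.pi fun _ => {i.succ}ᶜ := by
    ext a; simp
  have hnn : (0 : ℝ) ≤ 1 - 1 / (2 * n) := by
    rw [sub_nonneg, div_le_one (by positivity)]; linarith
  rw [hset, Measure.pi_pi, Finset.prod_const, Finset.card_univ, Fintype.card_fin,
    prob_compl_eq_one_sub (MeasurableSet.singleton _), hardIndexLaw_succ,
    ← ENNReal.ofReal_one, ← ENNReal.ofReal_sub _ (by positivity), ← ENNReal.ofReal_pow hnn,
    show (2 : ℝ≥0∞) = ENNReal.ofReal 2 by simp, ← ENNReal.ofReal_mul (by norm_num)]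
  refine ENNReal.ofReal_le_ofReal ?_
  have h := one_add_mul_le_pow (a := -(1 / (2 * (n : ℝ)))) (by linarith) n
  rw [← sub_eq_add_neg] at h
  have e : 1 + (n : ℝ) * -(1 / (2 * n)) = 1 / 2 := by field_simp; ring
  linarith

/-- If the training sample does not contain `eᵢ`, then the learner errs at `eᵢ` for exactly one of
two labellings that differ at `i` only. -/
lemma two_pow_le_two_mul_sum_error (A : Learner (EuclideanSpace ℝ (Fin d)) n) (i : Fin d)
    (a : Fin n → Fin (d + 1)) (ha : ∀ k, a k ≠ i.succ) :
    (2 ^ d : ℝ≥0∞) ≤ 2 * ∑ y : Fin d → Bool,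
      if A (hardPoint y ∘ a) (hardPoint y i.succ).1 ≠ (hardPoint y i.succ).2 then 1 else 0 := by
  set err : (Fin d → Bool) → ℝ≥0∞ := fun y =>
    if A (hardPoint y ∘ a) (hardPoint y i.succ).1 ≠ (hardPoint y i.succ).2 then 1 else 0
    with herr
  have hinv : Function.Involutive fun y : Fin d → Bool => flipAt y i := fun y => by
    simp [flipAt]
  have hflip : ∑ y, err (flipAt y i) = ∑ y, err y := Equiv.sum_comp hinv.toPerm err
  have hone : ∀ y, 1 ≤ err y + err (flipAt y i) := by
    intro y
    have hs : hardPoint (flipAt y i) ∘ a = hardPoint y ∘ a := by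
      funext k
      simp only [Function.comp_apply]
      have hk := ha k
      revert hk
      refine Fin.cases (fun _ => rfl) (fun j hk => ?_) (a k)
      have hji : j ≠ i := fun h => hk (by rw [h])
      simp [hardPoint, flipAt, hji]
    have hi : flipAt y i i = !y i := by simp [flipAt]
    have he : (hardPoint (flipAt y i) i.succ) = ((hardPoint y i.succ).1, !y i) := by
      simp [hardPoint, hi]
    have he' : (hardPoint y i.succ).2 = y i := rfl
    simp only [herr, hs, he, he']
    by_cases h : A (hardPoint y ∘ a) (hardPoint y i.succ).1 = y i <;> simp [h]
  calc (2 ^ d : ℝ≥0∞) = ∑ _y : Fin d → Bool, 1 := by simp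
    _ ≤ ∑ y, (err y + err (flipAt y i)) := Finset.sum_le_sum fun y _ => hone y
    _ = 2 * ∑ y, err y := by rw [Finset.sum_add_distrib, hflip, two_mul]

/-- The average of the expected risk over the `2 ^ d` hard distributions is at least
`d / (8n)`. -/
lemma mul_two_pow_le_sum_expectedRisk (hn : (d : ℝ) / 2 < n)
    (A : Learner (EuclideanSpace ℝ (Fin d)) n) :
    (d : ℝ≥0∞) * 2 ^ d ≤ 8 * n * ∑ y : Fin d → Bool, expectedRisk (hardLaw n y) A := by
  classical
  have hn0 : (0 : ℝ) < n := lt_of_le_of_lt (by positivity) hn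
  set P := Measure.pi fun _ : Fin n => hardIndexLaw d n with hP
  set p : ℝ≥0∞ := ENNReal.ofReal (1 / (2 * n)) with hp
  have hpn : 2 * n * p = 1 := by
    rw [hp, ← ENNReal.ofReal_natCast n, show (2 : ℝ≥0∞) = ENNReal.ofReal 2 by simp,
      ← ENNReal.ofReal_mul (by norm_num), ← ENNReal.ofReal_mul (by positivity),
      ← ENNReal.ofReal_one]
    congr 1
    field_simp
  let err : (Fin d → Bool) → (Fin n → Fin (d + 1)) → Fin (d + 1) → ℝ≥0∞ := fun y a o =>
    if A (hardPoint y ∘ a) (hardPoint y o).1 ≠ (hardPoint y o).2 then 1 else 0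
  have hterm : ∀ i : Fin d, (2 ^ d : ℝ≥0∞) ≤ 2 * (2 * ∑ a, P {a} * ∑ y, err y a i.succ) := by
    intro i
    calc (2 ^ d : ℝ≥0∞) ≤ 2 * P {a | ∀ k, a k ≠ i.succ} * 2 ^ d := by
          simpa using mul_le_mul_left (one_le_two_mul_measure_avoid hn i) (2 ^ d)
      _ = 2 * ∑ a, P {a} * if ∀ k, a k ≠ i.succ then 2 ^ d else 0 := by
          rw [mul_assoc, ← lintegral_indicator_one (Set.toFinite _).measurableSet,
            lintegral_fintype, Finset.sum_mul]
          congr 1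
          refine Finset.sum_congr rfl fun a _ => ?_
          by_cases h : ∀ k, a k ≠ i.succ
          · rw [Set.indicator_of_mem (by exact h), if_pos h, Pi.one_apply, one_mul]
          · rw [Set.indicator_of_notMem (by exact h), if_neg h]; simp
      _ ≤ 2 * ∑ a, P {a} * (2 * ∑ y, err y a i.succ) := by
          gcongr with a
          split_ifs with h
          · exact two_pow_le_two_mul_sum_error A i a h
          · exact zero_le
      _ = 2 * (2 * ∑ a, P {a} * ∑ y, err y a i.succ) := by
          congr 1
          rw [Finset.mul_sum]
          exact Finset.sum_congr rfl fun a _ => by ring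
  calc (d : ℝ≥0∞) * 2 ^ d = ∑ _i : Fin d, 2 ^ d := by simp
    _ ≤ ∑ i : Fin d, 2 * (2 * ∑ a, P {a} * ∑ y, err y a i.succ) :=
        Finset.sum_le_sum fun i _ => hterm i
    _ = 2 * n * p * ∑ i : Fin d, 2 * (2 * ∑ a, P {a} * ∑ y, err y a i.succ) := by
        rw [hpn, one_mul]
    _ = 8 * n * ∑ y, ∑ a, ∑ i : Fin d, P {a} * p * err y a i.succ := by
        have hswap : ∑ y, ∑ a, ∑ i : Fin d, P {a} * p * err y a i.succ
            = p * ∑ i : Fin d, ∑ a, P {a} * ∑ y, err y a i.succ := by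
          simp only [Finset.mul_sum]
          rw [Finset.sum_comm_cycle]
          refine Finset.sum_congr rfl fun i _ => ?_
          rw [Finset.sum_comm]
          exact Finset.sum_congr rfl fun a _ => Finset.sum_congr rfl fun y _ => by ring
        rw [hswap, ← Finset.mul_sum, ← Finset.mul_sum]
        ring
    _ ≤ 8 * n * ∑ y : Fin d → Bool, expectedRisk (hardLaw n y) A := by
        gcongr with y
        rw [expectedRisk_hardLaw hn]
        refine Finset.sum_le_sum fun a _ => ?_
        rw [Fin.sum_univ_succ]
        simp only [hardIndexLaw_succ]
        exact le_add_self

/-- Every randomized learner has expected risk at least `(d + 1) / (32n)` under some hard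
distribution, by averaging over the labellings. -/
lemma exists_le_lintegral_expectedRisk (hd : 1 ≤ d) (hn : (d : ℝ) / 2 < n) {Ω : Type*}
    [MeasurableSpace Ω] (P : Measure Ω) [IsProbabilityMeasure P]
    (A : Ω → Learner (EuclideanSpace ℝ (Fin d)) n)
    (hA : ∀ s x, Measurable fun ω => A ω s x) :
    ∃ y : Fin d → Bool, ENNReal.ofReal (1 / 32 * (((d : ℝ) + 1) / n))
      ≤ ∫⁻ ω, expectedRisk (hardLaw n y) (A ω) ∂P := by
  by_contra! hcon
  have hn0 : (0 : ℝ) < n := lt_of_le_of_lt (by positivity) hn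
  -- the integral over the randomness `ω` commutes with the sum over `y` by measurability
  have hmeas : ∀ y : Fin d → Bool, Measurable fun ω => expectedRisk (hardLaw n y) (A ω) := by
    intro y
    simp only [expectedRisk_hardLaw hn]
    refine Finset.measurable_sum _ fun a _ => Finset.measurable_sum _ fun o _ =>
      measurable_const.mul ?_
    exact (measurable_of_finite fun c : Bool =>
      if c ≠ (hardPoint y o).2 then (1 : ℝ≥0∞) else 0).comp (hA (hardPoint y ∘ a) (hardPoint y o).1)
  have key : (d : ℝ≥0∞) * 2 ^ d
      ≤ 8 * n * (2 ^ d * ENNReal.ofReal (1 / 32 * (((d : ℝ) + 1) / n))) := by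
    calc (d : ℝ≥0∞) * 2 ^ d = ∫⁻ _ω, (d : ℝ≥0∞) * 2 ^ d ∂P := by simp
      _ ≤ ∫⁻ ω, 8 * n * ∑ y : Fin d → Bool, expectedRisk (hardLaw n y) (A ω) ∂P :=
          lintegral_mono fun ω => mul_two_pow_le_sum_expectedRisk hn (A ω)
      _ = 8 * n * ∑ y : Fin d → Bool, ∫⁻ ω, expectedRisk (hardLaw n y) (A ω) ∂P := by
          rw [lintegral_const_mul' _ _ (ENNReal.mul_ne_top (by simp) (by simp)),
            lintegral_finsetSum _ fun y _ => hmeas y]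
      _ ≤ 8 * n * ∑ _y : Fin d → Bool, ENNReal.ofReal (1 / 32 * (((d : ℝ) + 1) / n)) := by
          gcongr with y
          exact (hcon y).le
      _ = _ := by simp
  have e : 8 * (n : ℝ≥0∞) * (2 ^ d * ENNReal.ofReal (1 / 32 * (((d : ℝ) + 1) / n)))
      = ENNReal.ofReal (((d : ℝ) + 1) / 4 * 2 ^ d) := by
    rw [← ENNReal.ofReal_natCast n, show (8 : ℝ≥0∞) = ENNReal.ofReal 8 by simp,
      show (2 : ℝ≥0∞) = ENNReal.ofReal 2 by simp, ← ENNReal.ofReal_pow (by norm_num),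
      ← ENNReal.ofReal_mul (by norm_num), ← ENNReal.ofReal_mul (by positivity),
      ← ENNReal.ofReal_mul (by positivity)]
    congr 1
    field_simp
    norm_num
  have e' : (d : ℝ≥0∞) * 2 ^ d = ENNReal.ofReal ((d : ℝ) * 2 ^ d) := by
    rw [ENNReal.ofReal_mul (by positivity), ENNReal.ofReal_pow (by norm_num)]
    simp
  rw [e, e', ENNReal.ofReal_le_ofReal_iff (by positivity)] at key
  have h2 : (0 : ℝ) < 2 ^ d := by positivity
  have h3 := le_of_mul_le_mul_right key h2
  have : (1 : ℝ) ≤ d := by exact_mod_cast hd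
  linarith

end LowerBound

end LearningTheory

theorem mainTheorem2 :
    -- the bounds on the CMI and on the expected risk of the SVM
    (∀ (d n : ℕ), (d : ℝ) / 2 < n →
      ∀ (D : Measure (LearningTheory.Example (EuclideanSpace ℝ (Fin d)))) [IsProbabilityMeasure D],
        LearningTheory.Realizable (LearningTheory.halfspaces d) D →
          LearningTheory.CMI D (LearningTheory.svm d n)
              ≤ ENNReal.ofReal (2 * ((d : ℝ) + 1) * Real.log 2) ∧
          LearningTheory.expectedRisk D (LearningTheory.svm d n)
              ≤ ENNReal.ofReal (2 * ((d : ℝ) + 1) / (n : ℝ))) ∧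
    -- the bound on the risk is optimal up to a constant factor among all, possibly randomized
    -- (with internal randomness `ω` of law `P`) and possibly improper, learners
    (∃ c : ℝ, 0 < c ∧ ∀ (d n : ℕ), 1 ≤ d → (d : ℝ) / 2 < n →
      ∀ (Ω : Type*) [MeasurableSpace Ω] (P : Measure Ω) [IsProbabilityMeasure P]
        (A : Ω → LearningTheory.Learner (EuclideanSpace ℝ (Fin d)) n),
        (∀ s x, Measurable fun ω => A ω s x) →
          ∃ D : Measure (LearningTheory.Example (EuclideanSpace ℝ (Fin d))),
            IsProbabilityMeasure D ∧
            LearningTheory.Realizable (LearningTheory.halfspaces d) D ∧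
            ENNReal.ofReal (c * (((d : ℝ) + 1) / (n : ℝ)))
              ≤ ∫⁻ ω, LearningTheory.expectedRisk D (A ω) ∂P) := by
  refine ⟨fun d n hdn D _ hD => ?_, 1 / 32, by norm_num, fun d n hd hdn Ω _ P _ A hA => ?_⟩
  · have hn0 : (0 : ℝ) < n := lt_of_le_of_lt (by positivity) hdn
    have hn : 0 < n := by exact_mod_cast hn0
    refine ⟨hD.cmi_svm_le hn, (hD.expectedRisk_svm_le hn).trans ?_⟩
    have h := LearningTheory.two_mul_div_succ_le (d := d) hn
    rw [ENNReal.ofReal_div_of_pos hn0, ENNReal.ofReal_natCast,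
      ENNReal.le_div_iff_mul_le (by simp [hn.ne']) (by simp), mul_comm]
    exact le_trans (by gcongr; exact le_self_add) h
  · obtain ⟨y, hy⟩ := LearningTheory.exists_le_lintegral_expectedRisk hd hdn P A hA
    have := LearningTheory.isProbabilityMeasure_hardIndexLaw hdn
    exact ⟨LearningTheory.hardLaw n y,
      Measure.isProbabilityMeasure_map (f := LearningTheory.hardPoint y)
        (measurable_of_finite _).aemeasurable,
      LearningTheory.realizable_hardLaw y, hy⟩
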